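/- Let $S$ be a finite regular semigroup (i.e. for every $a\in S$ there is $b\in S$ with $aba=a$). Call $S$ an inverse semigroup if for every $a\in S$ there is a unique $b\in S$ with $aba=a$ and $bab=b$. A matrix $A\in M_n(\mathbb{C})$ with conjugate transpose $A^{*}$ is preunitary if $AA^{*}A=A$, and a matrix representation of $S$ is semiunitary if all of its matrices are preunitary. Let $J$ be a $\mathcal{J}$-class of $S$. Choose an idempotent $e\in J$; let $G_e$ be the maximal subgroup at $e$, i.e. the group of units of the monoid $eSe$, and let $L_e$ and $R_e$ be the $\mathcal{L}$-class and the $\mathcal{R}$-class of $e$. Choose elements $x_1,\dots,x_m$ and $y_1,\dots,y_n$ such that, as disjoint unions, $L_e=\bigsqcup_{i=1}^m x_iG_e$ and $R_e=\bigsqcup_{j=1}^n G_ey_j$. For $s\in S$ let $M^l(s)=(g_{ji})\in M_m(\mathbb{C}[G_e])$, where $g_{ji}$ is the unique element of $G_e$ with $sx_i=x_jg_{ji}$ if there is one and $g_{ji}=0$ otherwise; let $M^r(s)=(h_{ji})\in M_n(\mathbb{C}[G_e])$, where $h_{ji}$ is the unique element of $G_e$ with $y_js=h_{ji}y_i$ if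 there is one and $h_{ji}=0$ otherwise. Choose irreducible complex matrix representations $\sigma_1,\dots,\sigma_k$ of $G_e$, exactly one from each equivalence class, and let $\sigma=\sigma_1\oplus\cdots\oplus\sigma_k$ (block diagonal). Applying $\sigma$, extended linearly to $\mathbb{C}[G_e]$, to the entries gives the matrix representations $\mathrm{Ind}_{G_e}(\sigma)\colon s\mapsto\sigma(M^l(s))$ and $\mathrm{Coind}_{G_e}(\sigma)\colon s\mapsto\sigma(M^r(s))$ of $S$. Such a pair $(\mathrm{Ind}_{G_e}(\sigma),\mathrm{Coind}_{G_e}(\sigma))$ is called a pair of left/right matrix Schützenberger representations of $S$ associated to $J$. Theorem. A finite regular semigroup $S$ is an inverse semigroup if and only if, for each $\mathcal{J}$-class $J$ of $S$, there exists a pair of left/right matrix Schützenberger representations of $S$ associated to $J$ (that is, a choice of $e$, of the $x_i$, of the $y_j$ and of $\sigma_1,\dots,\sigma_k$ as above) such that both representations are semiunitary. -/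

import Mathlib

open scoped Matrix

noncomputable section

namespace SemigroupRep

variable {S : Type*} [Semigroup S]

/-! ### Regular and inverse semigroups, Green's relations -/

/-- `S` is regular: every element `a` satisfies `a b a = a` for some `b`. -/
def IsRegularSemigroup (S : Type*) [Semigroup S] : Prop :=
  ∀ a : S, ∃ b : S, a * b * a = a

/-- `S` is an inverse semigroup: every element has a unique (generalized) inverse. -/
def IsInverseSemigroup (S : Type*) [Semigroup S] : Prop :=
  ∀ a : S, ∃! b : S, a * b * a = a ∧ b * a * b = b

/-- The principal left ideal `S¹ a`, as a subset of `S`.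
(Adjoining a new identity to a monoid does not change this set.) -/
def leftIdeal (a : S) : Set S := {b | ∃ u : WithOne S, (b : WithOne S) = u * a}

/-- The principal right ideal `a S¹`, as a subset of `S`. -/
def rightIdeal (a : S) : Set S := {b | ∃ u : WithOne S, (b : WithOne S) = a * u}

/-- The principal two-sided ideal `S¹ a S¹`, as a subset of `S`. -/
def twoSidedIdeal (a : S) : Set S := {b | ∃ u v : WithOne S, (b : WithOne S) = u * a * v}

/-- Green's relation `𝓛`. -/
def GreenL (a b : S) : Prop := leftIdeal a = leftIdeal b

/-- Green's relation `𝓡`. -/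
def GreenR (a b : S) : Prop := rightIdeal a = rightIdeal b

/-- Green's relation `𝓙`. -/
def GreenJ (a b : S) : Prop := twoSidedIdeal a = twoSidedIdeal b

/-! ### The maximal subgroup at an idempotent -/

section MaximalSubgroup

variable {e : S}

/-- The local monoid `e S e`, with identity `e`. -/
instance cornerMonoid (he : IsIdempotentElem e) : Monoid he.Corner where
  mul a b := ⟨a.1 * b.1, (Subsemigroup.corner e).mul_mem a.2 b.2⟩
  mul_assoc a b c := Subtype.ext (mul_assoc a.1 b.1 c.1)
  one := ⟨e, e, by simp only [he.eq]⟩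
  one_mul a := Subtype.ext ((Subsemigroup.mem_corner_iff he).mp a.2).1
  mul_one a := Subtype.ext ((Subsemigroup.mem_corner_iff he).mp a.2).2

/-- The maximal subgroup `G_e`: the group of units of the monoid `e S e`. -/
abbrev MaxSubgroup (he : IsIdempotentElem e) : Type _ := (he.Corner)ˣ

/-- The element of `S` underlying an element of `G_e`. -/
def MaxSubgroup.val {he : IsIdempotentElem e} (g : MaxSubgroup he) : S := g.1.1

variable {he : IsIdempotentElem e}

theorem MaxSubgroup.val_mul (g h : MaxSubgroup he) :
    MaxSubgroup.val (g * h) = g.val * MaxSubgroup.val h := rfl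

theorem MaxSubgroup.val_one : MaxSubgroup.val (1 : MaxSubgroup he) = e := rfl

theorem MaxSubgroup.val_mul_inv (g : MaxSubgroup he) :
    g.val * MaxSubgroup.val g⁻¹ = e := by
  rw [← MaxSubgroup.val_mul, mul_inv_cancel, MaxSubgroup.val_one]

theorem MaxSubgroup.inv_mul_val (g : MaxSubgroup he) :
    MaxSubgroup.val g⁻¹ * g.val = e := by
  rw [← MaxSubgroup.val_mul, inv_mul_cancel, MaxSubgroup.val_one]

theorem MaxSubgroup.idem_mul (g : MaxSubgroup he) : e * g.val = g.val :=
  ((Subsemigroup.mem_corner_iff he).mp g.1.2).1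

theorem MaxSubgroup.mul_idem (g : MaxSubgroup he) : g.val * e = g.val :=
  ((Subsemigroup.mem_corner_iff he).mp g.1.2).2

theorem MaxSubgroup.val_injective :
    Function.Injective (MaxSubgroup.val : MaxSubgroup he → S) :=
  fun _ _ h => Units.ext (Subtype.ext h)

end MaximalSubgroup

/-! ### Elementary facts on `𝓛` and `𝓡` -/

theorem self_mem_leftIdeal (a : S) : a ∈ leftIdeal a := ⟨1, (one_mul _).symm⟩

theorem self_mem_rightIdeal (a : S) : a ∈ rightIdeal a := ⟨1, (mul_one _).symm⟩

theorem greenL_iff {a b : S} : GreenL a b ↔ a ∈ leftIdeal b ∧ b ∈ leftIdeal a := by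
  constructor
  · intro h
    exact ⟨h ▸ self_mem_leftIdeal a, h.symm ▸ self_mem_leftIdeal b⟩
  · rintro ⟨⟨u, hu⟩, ⟨v, hv⟩⟩
    ext c
    constructor
    · rintro ⟨w, hw⟩
      exact ⟨w * u, by rw [hw, hu, mul_assoc]⟩
    · rintro ⟨w, hw⟩
      exact ⟨w * v, by rw [hw, hv, mul_assoc]⟩

theorem greenR_iff {a b : S} : GreenR a b ↔ a ∈ rightIdeal b ∧ b ∈ rightIdeal a := by
  constructor
  · intro h
    exact ⟨h ▸ self_mem_rightIdeal a, h.symm ▸ self_mem_rightIdeal b⟩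
  · rintro ⟨⟨u, hu⟩, ⟨v, hv⟩⟩
    ext c
    constructor
    · rintro ⟨w, hw⟩
      exact ⟨u * w, by rw [hw, hu, mul_assoc]⟩
    · rintro ⟨w, hw⟩
      exact ⟨v * w, by rw [hw, hv, mul_assoc]⟩

theorem mul_idem_of_greenL {e x : S} (he : IsIdempotentElem e) (h : GreenL x e) :
    x * e = x := by
  obtain ⟨u, hu⟩ := (greenL_iff.1 h).1
  apply WithOne.coe_injective
  rw [WithOne.coe_mul, hu, mul_assoc, ← WithOne.coe_mul, he.eq]

theorem idem_mul_of_greenR {e y : S} (he : IsIdempotentElem e) (h : GreenR y e) :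
    e * y = y := by
  obtain ⟨u, hu⟩ := (greenR_iff.1 h).1
  apply WithOne.coe_injective
  rw [WithOne.coe_mul, hu, ← mul_assoc, ← WithOne.coe_mul, he.eq]

theorem MaxSubgroup.eq_of_left {e x : S} {he : IsIdempotentElem e} (hx : GreenL x e)
    {g h : MaxSubgroup he} (H : x * g.val = x * h.val) : g = h := by
  obtain ⟨u, hu⟩ := (greenL_iff.1 hx).2
  apply MaxSubgroup.val_injective
  rw [← g.idem_mul, ← h.idem_mul]
  apply WithOne.coe_injective
  rw [WithOne.coe_mul, WithOne.coe_mul, hu, mul_assoc, mul_assoc, ← WithOne.coe_mul, H,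
    WithOne.coe_mul]

theorem MaxSubgroup.eq_of_right {e y : S} {he : IsIdempotentElem e} (hy : GreenR y e)
    {g h : MaxSubgroup he} (H : g.val * y = h.val * y) : g = h := by
  obtain ⟨u, hu⟩ := (greenR_iff.1 hy).2
  apply MaxSubgroup.val_injective
  rw [← g.mul_idem, ← h.mul_idem]
  apply WithOne.coe_injective
  rw [WithOne.coe_mul, WithOne.coe_mul, hu, ← mul_assoc, ← mul_assoc, ← WithOne.coe_mul, H,
    WithOne.coe_mul]

/-- If `s t x ∈ x' G_e` with `x, x' ∈ L_e`, then already `t x ∈ L_e`. -/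
theorem greenL_of_mul {e s t x x' : S} {he : IsIdempotentElem e} (hx : GreenL x e)
    (hx' : GreenL x' e) (g : MaxSubgroup he) (H : s * t * x = x' * g.val) :
    GreenL (t * x) e := by
  rw [greenL_iff]
  obtain ⟨u, hu⟩ := (greenL_iff.1 hx).1
  obtain ⟨v, hv⟩ := (greenL_iff.1 hx').2
  refine ⟨⟨t * u, by rw [WithOne.coe_mul, hu, mul_assoc]⟩,
    ⟨(MaxSubgroup.val g⁻¹ : S) * v * s, ?_⟩⟩
  calc (e : WithOne S) = (MaxSubgroup.val g⁻¹ : S) * (e * (g.val : S)) := by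
        rw [← WithOne.coe_mul, ← WithOne.coe_mul, g.idem_mul, g.inv_mul_val]
    _ = (MaxSubgroup.val g⁻¹ : S) * (v * ((x' * g.val : S) : WithOne S)) := by
        rw [hv, WithOne.coe_mul]; simp only [mul_assoc]
    _ = _ := by rw [← H]; simp only [WithOne.coe_mul, mul_assoc]

/-- If `y s t ∈ G_e y'` with `y, y' ∈ R_e`, then already `y s ∈ R_e`. -/
theorem greenR_of_mul {e s t y y' : S} {he : IsIdempotentElem e} (hy : GreenR y e)
    (hy' : GreenR y' e) (g : MaxSubgroup he) (H : y * (s * t) = g.val * y') :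
    GreenR (y * s) e := by
  rw [greenR_iff]
  obtain ⟨u, hu⟩ := (greenR_iff.1 hy).1
  obtain ⟨v, hv⟩ := (greenR_iff.1 hy').2
  refine ⟨⟨u * s, by rw [WithOne.coe_mul, hu, mul_assoc]⟩,
    ⟨t * (v * (MaxSubgroup.val g⁻¹ : S)), ?_⟩⟩
  calc (e : WithOne S) = ((g.val : S) * e) * (MaxSubgroup.val g⁻¹ : S) := by
        rw [← WithOne.coe_mul, ← WithOne.coe_mul, g.mul_idem, g.val_mul_inv]
    _ = (((g.val * y' : S) : WithOne S) * v) * (MaxSubgroup.val g⁻¹ : S) := by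
        rw [hv, WithOne.coe_mul]; simp only [mul_assoc]
    _ = _ := by rw [← H]; simp only [WithOne.coe_mul, mul_assoc]

/-! ### Schützenberger representations over the group algebra `ℂ[G_e]` -/

/-- Representatives `x₁, …, x_m` with `L_e = ⨆ᵢ xᵢ G_e` (disjoint union). -/
structure LeftTransversal {e : S} (he : IsIdempotentElem e) (m : ℕ) where
  x : Fin m → S
  mem : ∀ i, GreenL (x i) e
  cover : ∀ l, GreenL l e → ∃ (i : Fin m) (g : MaxSubgroup he), l = x i * g.val
  disjoint : ∀ (i j : Fin m) (g h : MaxSubgroup he), x i * g.val = x j * h.val → i = j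

/-- Representatives `y₁, …, y_n` with `R_e = ⨆ⱼ G_e yⱼ` (disjoint union). -/
structure RightTransversal {e : S} (he : IsIdempotentElem e) (n : ℕ) where
  y : Fin n → S
  mem : ∀ j, GreenR (y j) e
  cover : ∀ r, GreenR r e → ∃ (j : Fin n) (g : MaxSubgroup he), r = g.val * y j
  disjoint : ∀ (i j : Fin n) (g h : MaxSubgroup he), g.val * y i = h.val * y j → i = j

section Schutzenberger

variable {e : S} {he : IsIdempotentElem e} {m n : ℕ}

open Classical in
/-- The matrix `(g_{ji})` of `s` over `ℂ[G_e]`: `g_{ji}` is the unique `g ∈ G_e` with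
`s xᵢ = xⱼ g` if there is one (so that `s xᵢ ∈ L_e`), and `0` otherwise. -/
def LeftTransversal.schutzMatrix (X : LeftTransversal he m) (s : S) :
    Matrix (Fin m) (Fin m) (MonoidAlgebra ℂ (MaxSubgroup he)) :=
  Matrix.of fun j i =>
    if h : ∃ g : MaxSubgroup he, s * X.x i = X.x j * g.val then
      MonoidAlgebra.single h.choose 1 else 0

open Classical in
/-- The matrix `(h_{ji})` of `s` over `ℂ[G_e]`: `h_{ji}` is the unique `h ∈ G_e` with
`yⱼ s = h yᵢ` if there is one (so that `yⱼ s ∈ R_e`), and `0` otherwise. -/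
def RightTransversal.schutzMatrix (Y : RightTransversal he n) (s : S) :
    Matrix (Fin n) (Fin n) (MonoidAlgebra ℂ (MaxSubgroup he)) :=
  Matrix.of fun j i =>
    if h : ∃ g : MaxSubgroup he, Y.y j * s = g.val * Y.y i then
      MonoidAlgebra.single h.choose 1 else 0

theorem LeftTransversal.schutzMatrix_eq (X : LeftTransversal he m) {s : S} {i j : Fin m}
    {g : MaxSubgroup he} (H : s * X.x i = X.x j * g.val) :
    X.schutzMatrix s j i = MonoidAlgebra.single g 1 := by
  have h : ∃ g : MaxSubgroup he, s * X.x i = X.x j * g.val := ⟨g, H⟩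
  have hg : h.choose = g := MaxSubgroup.eq_of_left (X.mem j) (h.choose_spec.symm.trans H)
  simp only [schutzMatrix, Matrix.of_apply, dif_pos h, hg]

theorem LeftTransversal.schutzMatrix_eq_zero (X : LeftTransversal he m) {s : S} {i j : Fin m}
    (H : ∀ g : MaxSubgroup he, s * X.x i ≠ X.x j * g.val) :
    X.schutzMatrix s j i = 0 := by
  have h : ¬ ∃ g : MaxSubgroup he, s * X.x i = X.x j * g.val := fun ⟨g, hg⟩ => H g hg
  simp only [schutzMatrix, Matrix.of_apply, dif_neg h]

theorem RightTransversal.schutzMatrix_eq (Y : RightTransversal he n) {s : S} {i j : Fin n}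
    {g : MaxSubgroup he} (H : Y.y j * s = g.val * Y.y i) :
    Y.schutzMatrix s j i = MonoidAlgebra.single g 1 := by
  have h : ∃ g : MaxSubgroup he, Y.y j * s = g.val * Y.y i := ⟨g, H⟩
  have hg : h.choose = g := MaxSubgroup.eq_of_right (Y.mem i) (h.choose_spec.symm.trans H)
  simp only [schutzMatrix, Matrix.of_apply, dif_pos h, hg]

theorem RightTransversal.schutzMatrix_eq_zero (Y : RightTransversal he n) {s : S} {i j : Fin n}
    (H : ∀ g : MaxSubgroup he, Y.y j * s ≠ g.val * Y.y i) :
    Y.schutzMatrix s j i = 0 := by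
  have h : ¬ ∃ g : MaxSubgroup he, Y.y j * s = g.val * Y.y i := fun ⟨g, hg⟩ => H g hg
  simp only [schutzMatrix, Matrix.of_apply, dif_neg h]

theorem LeftTransversal.schutzMatrix_mul (X : LeftTransversal he m) (s t : S) :
    X.schutzMatrix (s * t) = X.schutzMatrix s * X.schutzMatrix t := by
  ext1 k i
  rw [Matrix.mul_apply]
  by_cases h : GreenL (t * X.x i) e
  · obtain ⟨j, b, hb⟩ := X.cover _ h
    rw [Finset.sum_eq_single j, X.schutzMatrix_eq hb]
    · by_cases h' : ∃ g : MaxSubgroup he, s * X.x j = X.x k * g.val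
      · obtain ⟨g, hg⟩ := h'
        rw [X.schutzMatrix_eq hg, MonoidAlgebra.single_mul_single, one_mul]
        apply X.schutzMatrix_eq
        rw [mul_assoc, hb, ← mul_assoc, hg, mul_assoc, MaxSubgroup.val_mul]
      · rw [X.schutzMatrix_eq_zero (fun g hg => h' ⟨g, hg⟩), zero_mul]
        apply X.schutzMatrix_eq_zero
        intro g hg
        refine h' ⟨g * b⁻¹, ?_⟩
        rw [MaxSubgroup.val_mul, ← mul_assoc, ← hg, mul_assoc, mul_assoc, ← mul_assoc t, hb,
          mul_assoc, b.val_mul_inv, mul_idem_of_greenL he (X.mem j)]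
    · intro j' _ hj'
      rw [X.schutzMatrix_eq_zero (s := t), mul_zero]
      intro g hg
      exact hj' (X.disjoint _ _ _ _ (hg.symm.trans hb))
    · intro hj
      exact absurd (Finset.mem_univ j) hj
  · rw [Finset.sum_eq_zero, X.schutzMatrix_eq_zero]
    · intro g hg
      exact h (greenL_of_mul (X.mem i) (X.mem k) g hg)
    · intro j _
      rw [X.schutzMatrix_eq_zero (s := t), mul_zero]
      intro g hg
      have hg' : t * X.x i * MaxSubgroup.val g⁻¹ = X.x j := by
        rw [hg, mul_assoc, g.val_mul_inv, mul_idem_of_greenL he (X.mem j)]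
      apply h
      rw [greenL_iff]
      obtain ⟨u, hu⟩ := (greenL_iff.1 (X.mem i)).1
      obtain ⟨v, hv⟩ := (greenL_iff.1 (X.mem j)).2
      refine ⟨⟨t * u, by rw [WithOne.coe_mul, hu, mul_assoc]⟩,
        ⟨(MaxSubgroup.val g⁻¹ : S) * v, ?_⟩⟩
      rw [hg, WithOne.coe_mul, mul_assoc, ← mul_assoc v, ← hv, ← WithOne.coe_mul,
        ← WithOne.coe_mul, g.idem_mul, g.inv_mul_val]

theorem RightTransversal.schutzMatrix_mul (Y : RightTransversal he n) (s t : S) :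
    Y.schutzMatrix (s * t) = Y.schutzMatrix s * Y.schutzMatrix t := by
  ext1 k i
  rw [Matrix.mul_apply]
  by_cases h : GreenR (Y.y k * s) e
  · obtain ⟨j, b, hb⟩ := Y.cover _ h
    rw [Finset.sum_eq_single j, Y.schutzMatrix_eq hb]
    · by_cases h' : ∃ g : MaxSubgroup he, Y.y j * t = g.val * Y.y i
      · obtain ⟨g, hg⟩ := h'
        rw [Y.schutzMatrix_eq hg, MonoidAlgebra.single_mul_single, one_mul]
        apply Y.schutzMatrix_eq
        rw [← mul_assoc, hb, mul_assoc, hg, ← mul_assoc, MaxSubgroup.val_mul]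
      · rw [Y.schutzMatrix_eq_zero (fun g hg => h' ⟨g, hg⟩), mul_zero]
        apply Y.schutzMatrix_eq_zero
        intro g hg
        refine h' ⟨b⁻¹ * g, ?_⟩
        rw [MaxSubgroup.val_mul, mul_assoc, ← hg, ← mul_assoc (Y.y k), hb, ← mul_assoc,
          ← mul_assoc, b.inv_mul_val, idem_mul_of_greenR he (Y.mem j)]
    · intro j' _ hj'
      rw [Y.schutzMatrix_eq_zero (s := s), zero_mul]
      intro g hg
      exact hj' (Y.disjoint _ _ _ _ (hg.symm.trans hb))
    · intro hj
      exact absurd (Finset.mem_univ j) hj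
  · rw [Finset.sum_eq_zero, Y.schutzMatrix_eq_zero]
    · intro g hg
      exact h (greenR_of_mul (Y.mem k) (Y.mem i) g hg)
    · intro j _
      rw [Y.schutzMatrix_eq_zero (s := s), zero_mul]
      intro g hg
      apply h
      rw [greenR_iff]
      obtain ⟨u, hu⟩ := (greenR_iff.1 (Y.mem k)).1
      obtain ⟨v, hv⟩ := (greenR_iff.1 (Y.mem j)).2
      refine ⟨⟨u * s, by rw [WithOne.coe_mul, hu, mul_assoc]⟩,
        ⟨v * (MaxSubgroup.val g⁻¹ : S), ?_⟩⟩
      rw [hg, WithOne.coe_mul, ← mul_assoc, mul_assoc (g.val : WithOne S), ← hv,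
        ← WithOne.coe_mul, ← WithOne.coe_mul, g.mul_idem, g.val_mul_inv]

/-- The left Schützenberger representation `s ↦ (g_{ji})` of `S` over `ℂ[G_e]`. -/
def LeftTransversal.schutz (X : LeftTransversal he m) :
    S →ₙ* Matrix (Fin m) (Fin m) (MonoidAlgebra ℂ (MaxSubgroup he)) where
  toFun := X.schutzMatrix
  map_mul' := X.schutzMatrix_mul

/-- The right Schützenberger representation `s ↦ (h_{ji})` of `S` over `ℂ[G_e]`. -/
def RightTransversal.schutz (Y : RightTransversal he n) :
    S →ₙ* Matrix (Fin n) (Fin n) (MonoidAlgebra ℂ (MaxSubgroup he)) where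
  toFun := Y.schutzMatrix
  map_mul' := Y.schutzMatrix_mul

end Schutzenberger

/-! ### Matrix representations of a group -/

section MatrixRep

variable {G : Type*} [Group G]

/-- A complex matrix representation, as a representation on column vectors. -/
def toRepresentation {d : ℕ} (σ : G →* Matrix (Fin d) (Fin d) ℂ) :
    Representation ℂ G (Fin d → ℂ) :=
  (Matrix.toLinAlgEquiv' : Matrix (Fin d) (Fin d) ℂ ≃ₐ[ℂ] _).toMonoidHom.comp σ

/-- `σ₁, …, σ_k` is a complete list of pairwise inequivalent irreducible complex matrix
representations of `G`. -/
structure IsCompleteIrreducibleList {k : ℕ} {d : Fin k → ℕ}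
    (σ : ∀ i, G →* Matrix (Fin (d i)) (Fin (d i)) ℂ) : Prop where
  irreducible : ∀ i, (toRepresentation (σ i)).IsIrreducible
  inequivalent : ∀ i j,
    Nonempty ((toRepresentation (σ i)).Equiv (toRepresentation (σ j))) → i = j
  complete : ∀ (n : ℕ) (τ : G →* Matrix (Fin n) (Fin n) ℂ), (toRepresentation τ).IsIrreducible →
    ∃ i, Nonempty ((toRepresentation τ).Equiv (toRepresentation (σ i)))

/-- The block-diagonal direct sum `σ₁ ⊕ ⋯ ⊕ σ_k` of matrix representations. -/
def directSum {k : ℕ} {d : Fin k → ℕ} (σ : ∀ i, G →* Matrix (Fin (d i)) (Fin (d i)) ℂ) :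
    G →* Matrix (Σ i, Fin (d i)) (Σ i, Fin (d i)) ℂ :=
  (Matrix.blockDiagonal'RingHom (fun i => Fin (d i)) ℂ).toMonoidHom.comp (MonoidHom.pi σ)

/-- A matrix representation `σ` of `G`, extended linearly to `ℂ[G]`, applied to every entry of a
matrix over `ℂ[G]`; the result is read as one big block matrix. -/
def applyEntries {ι d : Type*} [Fintype ι] [DecidableEq ι] [Fintype d] [DecidableEq d]
    (σ : G →* Matrix d d ℂ) :
    Matrix ι ι (MonoidAlgebra ℂ G) →+* Matrix (ι × d) (ι × d) ℂ :=
  (Matrix.compRingEquiv ι d ℂ).toRingHom.comp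
    (MonoidAlgebra.lift ℂ (Matrix d d ℂ) G σ).toRingHom.mapMatrix

end MatrixRep

/-! ### Induced, coinduced and semiunitary representations -/

section

variable {e : S} {he : IsIdempotentElem e} {m n : ℕ} {d : Type*} [Fintype d] [DecidableEq d]

/-- The matrix representation `Ind_{G_e}(σ)` of `S` with respect to representatives of
`L_e / G_e`: the entries of the left Schützenberger matrices are replaced by their images
under `σ`. -/
def indRep (X : LeftTransversal he m) (σ : MaxSubgroup he →* Matrix d d ℂ) :
    S →ₙ* Matrix (Fin m × d) (Fin m × d) ℂ where
  toFun s := applyEntries σ (X.schutz s)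
  map_mul' s t := by rw [map_mul, map_mul]

/-- The matrix representation `Coind_{G_e}(σ)` of `S` with respect to representatives of
`G_e \ R_e`: the entries of the right Schützenberger matrices are replaced by their images
under `σ`. -/
def coindRep (Y : RightTransversal he n) (σ : MaxSubgroup he →* Matrix d d ℂ) :
    S →ₙ* Matrix (Fin n × d) (Fin n × d) ℂ where
  toFun s := applyEntries σ (Y.schutz s)
  map_mul' s t := by rw [map_mul, map_mul]

/-- A matrix is preunitary if `A A* A = A`, with `A*` the conjugate transpose. -/
def IsPreunitary {ι : Type*} [Fintype ι] (A : Matrix ι ι ℂ) : Prop := A * Aᴴ * A = A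

/-- A matrix representation of `S` is semiunitary if all its matrices are preunitary. -/
def IsSemiunitary {ι : Type*} [Fintype ι] (π : S →ₙ* Matrix ι ι ℂ) : Prop :=
  ∀ s, IsPreunitary (π s)

end

/-- There is a pair `(Ind σ, Coind σ)` of semiunitary left / right matrix Schützenberger
representations associated to the `𝓙`-class of `a`: for some idempotent `e` of this class, some
representatives of `L_e / G_e` and of `G_e \ R_e`, and some complete list `σ₁, …, σ_k` of
irreducible matrix representations of `G_e`, with `σ = σ₁ ⊕ ⋯ ⊕ σ_k`. -/
def HasSemiunitarySchutzenbergerPair (a : S) : Prop :=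
  ∃ (e : S) (he : IsIdempotentElem e), GreenJ e a ∧
    ∃ (m n : ℕ) (X : LeftTransversal he m) (Y : RightTransversal he n)
      (k : ℕ) (d : Fin k → ℕ) (σ : ∀ i, MaxSubgroup he →* Matrix (Fin (d i)) (Fin (d i)) ℂ),
      IsCompleteIrreducibleList σ ∧
      IsSemiunitary (indRep X (directSum σ)) ∧ IsSemiunitary (coindRep Y (directSum σ))

end SemigroupRep

end

/-!
# Semiunitary Schützenberger representations characterise finite inverse semigroups

Suppose that `S` is inverse. By Weyl's averaging trick (`exists_unitary_equiv`) the irreducible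
representations of `G_e` can be chosen unitary, and orthogonality of characters makes the list of
them finite (`finite_of_pairwise_inequivalent`). Idempotents commute, so `s` and its inverse `s⁻¹`
act on `L_e` by mutually inverse partial injections: `s xᵢ = xⱼ g` if and only if
`s⁻¹ xⱼ = xᵢ g⁻¹`. Hence `Ind σ (s⁻¹)` is the conjugate transpose of `Ind σ (s)`, and
preunitarity is the image of the identity `s s⁻¹ s = s`. The argument for `Coind σ` on `R_e` is the
mirror image.

Conversely, a regular semigroup is inverse as soon as no two distinct idempotents are `𝓛`-related
or `𝓡`-related (`isInverseSemigroup_of_forall_idempotent`). An idempotent preunitary matrix is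
Hermitian, so if `a b = a` and `b a = b` for idempotents `a` and `b`, then
`Ind σ a = (Ind σ a · Ind σ b)ᴴ = Ind σ b · Ind σ a = Ind σ b`. Finiteness gives `p ∈ R_a ∩ L_e`
(`GreenJ.exists_eq_mul`), where `e` is the idempotent chosen in the `𝓙`-class of `a`. As `a p = p`,
the diagonal block of `Ind σ a` at the representative of `p G_e` is an identity matrix. It has
positive size, since `σ` contains the trivial representation, so that block of `Ind σ b` is nonzero
as well. This forces `b p = p`, whence `b a = a`, and `a = b`. Dually, `Coind σ` separates
`𝓡`-related idempotents. Only the positions of the nonzero entries matter here; faithfulness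
of `σ` plays no role.
-/

namespace SemigroupRep

/-! ### Preunitary matrices -/

section Matrices

variable {ι : Type*} [Fintype ι]

/-- With `P = A Aᴴ` one has `A P = P = P Aᴴ`, so that `(A - P) (A - P)ᴴ = 0` and `A = P`. -/
theorem IsPreunitary.isHermitian_of_isIdempotentElem {A : Matrix ι ι ℂ} (hA : IsPreunitary A)
    (h : IsIdempotentElem A) : A.IsHermitian := by
  have h1 : A * (A * Aᴴ) = A * Aᴴ := by rw [← mul_assoc, h.eq]
  have h2 : A * Aᴴ * Aᴴ = A * Aᴴ := by
    simpa [Matrix.conjTranspose_mul, mul_assoc] using congrArg Matrix.conjTranspose h1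
  have h3 : A * Aᴴ * (A * Aᴴ) = A * Aᴴ := by rw [← mul_assoc, hA]
  have h4 : (A - A * Aᴴ) * (A - A * Aᴴ)ᴴ = 0 := by
    rw [Matrix.conjTranspose_sub, Matrix.conjTranspose_mul, Matrix.conjTranspose_conjTranspose,
      sub_mul, mul_sub, mul_sub, h1, h2, h3, sub_self]
  open scoped ComplexOrder in
  have h5 : A = A * Aᴴ := sub_eq_zero.1 (Matrix.self_mul_conjTranspose_eq_zero.1 h4)
  rw [h5]
  exact Matrix.isHermitian_mul_conjTranspose_self A

theorem applyEntries_apply {G κ d : Type*} [Group G] [Fintype κ] [DecidableEq κ] [Fintype d]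
    [DecidableEq d] (σ : G →* Matrix d d ℂ) (M : Matrix κ κ (MonoidAlgebra ℂ G)) (i j : κ × d) :
    applyEntries σ M i j = MonoidAlgebra.lift ℂ (Matrix d d ℂ) G σ (M i.1 j.1) i.2 j.2 := rfl

/-- For unitary `σ`, transposing a matrix of group elements and zeros and inverting its nonzero
entries becomes the conjugate transpose. -/
theorem applyEntries_eq_conjTranspose {G κ d : Type*} [Group G] [Fintype κ] [DecidableEq κ]
    [Fintype d] [DecidableEq d] {σ : G →* Matrix d d ℂ} (hσ : ∀ g, σ g⁻¹ = (σ g)ᴴ)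
    {M N : Matrix κ κ (MonoidAlgebra ℂ G)}
    (h : ∀ i j, (M j i = 0 ∧ N i j = 0) ∨
      ∃ g : G, M j i = MonoidAlgebra.single g 1 ∧ N i j = MonoidAlgebra.single g⁻¹ 1) :
    applyEntries σ N = (applyEntries σ M)ᴴ := by
  ext i j
  rw [Matrix.conjTranspose_apply, applyEntries_apply, applyEntries_apply]
  obtain ⟨h1, h2⟩ | ⟨g, h1, h2⟩ := h i.1 j.1
  · rw [h1, h2]; simp
  · rw [h1, h2, MonoidAlgebra.lift_single, MonoidAlgebra.lift_single, one_smul, one_smul, hσ,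
      Matrix.conjTranspose_apply]

end Matrices

/-! ### Unitary irreducible representations of a finite group -/

section Group

variable {G : Type*} [Group G]

/-- With `P = ∑ g, (τ g)ᴴ τ g = Qᴴ Q`, which is positive definite and satisfies
`(τ h)ᴴ P τ h = P`, the representation `g ↦ Q τ g Q⁻¹` is unitary. -/
theorem exists_unitary_equiv [Finite G] {n : ℕ} (τ : G →* Matrix (Fin n) (Fin n) ℂ) :
    ∃ σ : G →* Matrix (Fin n) (Fin n) ℂ, (∀ g, σ g⁻¹ = (σ g)ᴴ) ∧
      Nonempty ((toRepresentation τ).Equiv (toRepresentation σ)) := by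
  open scoped MatrixOrder Matrix.Norms.L2Operator ComplexOrder in
  cases nonempty_fintype G
  have hu : ∀ g, IsUnit (τ g) := fun g => (Group.isUnit g).map τ
  obtain ⟨Q, hQ, hP⟩ : ∃ Q : Matrix (Fin n) (Fin n) ℂ, IsUnit Q ∧
      ∑ g, (τ g)ᴴ * τ g = Qᴴ * Q := by
    have hpos : (∑ g, (τ g)ᴴ * τ g).PosDef := by
      refine Matrix.posDef_sum Finset.univ_nonempty fun g _ => ?_
      exact Matrix.PosDef.conjTranspose_mul_self _ (Matrix.mulVec_injective_iff_isUnit.2 (hu g))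
    obtain ⟨Q, hQ⟩ := CStarAlgebra.nonneg_iff_eq_star_mul_self.mp hpos.posSemidef.nonneg
    refine ⟨Q, ?_, hQ⟩
    have := hpos.isUnit
    rw [hQ] at this
    exact isUnit_of_mul_isUnit_right this
  have hinv : ∀ h, (τ h)ᴴ * (Qᴴ * Q) * τ h = Qᴴ * Q := by
    intro h
    rw [← hP, Finset.mul_sum, Finset.sum_mul]
    refine Fintype.sum_equiv (Equiv.mulRight h) _ _ fun g => ?_
    simp [Matrix.conjTranspose_mul, mul_assoc]
  obtain ⟨U, rfl⟩ := hQ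
  let σ : G →* Matrix (Fin n) (Fin n) ℂ :=
    { toFun := fun g => U * τ g * (U⁻¹ : (Matrix (Fin n) (Fin n) ℂ)ˣ)
      map_one' := by simp
      map_mul' := fun g h => by simp [mul_assoc] }
  have hσ : ∀ g, σ g = U * τ g * (U⁻¹ : (Matrix (Fin n) (Fin n) ℂ)ˣ) := fun _ => rfl
  refine ⟨σ, fun g => ?_, ⟨Representation.Equiv.mk
    (LinearEquiv.ofLinearMap (Matrix.toLin' (U : Matrix (Fin n) (Fin n) ℂ))
      (Matrix.toLin' ((U⁻¹ : (Matrix (Fin n) (Fin n) ℂ)ˣ) : Matrix (Fin n) (Fin n) ℂ)) ?_ ?_)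
    fun g => ?_⟩⟩
  · have h1 : (σ g)ᴴ * σ g = 1 := by
      have hU : ((U⁻¹ : (Matrix (Fin n) (Fin n) ℂ)ˣ) : Matrix (Fin n) (Fin n) ℂ)ᴴ *
          (U : Matrix (Fin n) (Fin n) ℂ)ᴴ = 1 := by
        rw [← Matrix.conjTranspose_mul, Units.mul_inv, Matrix.conjTranspose_one]
      calc (σ g)ᴴ * σ g = ((U⁻¹ : (Matrix (Fin n) (Fin n) ℂ)ˣ) : Matrix (Fin n) (Fin n) ℂ)ᴴ *
            ((τ g)ᴴ * ((U : Matrix (Fin n) (Fin n) ℂ)ᴴ * U) * τ g) *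
              (U⁻¹ : (Matrix (Fin n) (Fin n) ℂ)ˣ) := by
            simp only [hσ, Matrix.conjTranspose_mul, mul_assoc]
        _ = 1 := by rw [hinv, ← mul_assoc, hU, one_mul, Units.mul_inv]
    exact (left_inv_eq_right_inv h1 (by rw [← map_mul, mul_inv_cancel, map_one])).symm
  · rw [← Matrix.toLin'_mul, Units.mul_inv, Matrix.toLin'_one]
  · rw [← Matrix.toLin'_mul, Units.inv_mul, Matrix.toLin'_one]
  · change Matrix.toLin' _ ∘ₗ Matrix.toLin' (τ g) = Matrix.toLin' (σ g) ∘ₗ Matrix.toLin' _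
    rw [← Matrix.toLin'_mul, ← Matrix.toLin'_mul, hσ, mul_assoc _ _ (U : Matrix (Fin n) (Fin n) ℂ),
      Units.inv_mul, mul_one]

theorem isIrreducible_of_equiv {k V W : Type*} [Field k] [AddCommGroup V] [Module k V]
    [AddCommGroup W] [Module k W] {ρ : Representation k G V} {σ : Representation k G W}
    (φ : ρ.Equiv σ) (h : ρ.IsIrreducible) : σ.IsIrreducible := by
  rw [Representation.irreducible_iff_isSimpleModule_asModule] at h ⊢
  refine IsSimpleModule.congr (N := ρ.asModule) (LinearEquiv.ofBijective
    (Representation.IntertwiningMap.equivLinearMapAsModule σ ρ φ.symm.toIntertwiningMap) ?_)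
  exact φ.symm.toLinearEquiv.bijective

/-- Characters of pairwise inequivalent irreducible representations are orthonormal, hence linearly
independent in the finite-dimensional space `G → ℂ`. -/
theorem finite_of_pairwise_inequivalent [Finite G] {ι : Type*} {d : ι → ℕ}
    (σ : ∀ i, G →* Matrix (Fin (d i)) (Fin (d i)) ℂ)
    (hirr : ∀ i, (toRepresentation (σ i)).IsIrreducible)
    (hne : ∀ i j, Nonempty ((toRepresentation (σ i)).Equiv (toRepresentation (σ j))) → i = j) :
    Finite ι := by
  classical
  cases nonempty_fintype G
  have hG : (Nat.card G : ℂ) ≠ 0 := Nat.cast_ne_zero.2 Nat.card_pos.ne'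
  let _ := invertibleOfNonzero hG
  have hlin : LinearIndependent ℂ fun i => (toRepresentation (σ i)).character := by
    rw [linearIndependent_iff']
    intro s c hc i hi
    have := hirr
    have key : ∑ j ∈ s, c j * ((Nat.card G : ℂ)⁻¹ * ∑ g : G,
        (toRepresentation (σ j)).character g * (toRepresentation (σ i)).character g⁻¹) = 0 := by
      have h0 : ∀ g, ∑ j ∈ s, c j * (toRepresentation (σ j)).character g = 0 := fun g => by
        simpa using congrFun hc g
      simp_rw [Finset.mul_sum]
      rw [Finset.sum_comm]
      refine Finset.sum_eq_zero fun g _ => ?_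
      rw [← mul_zero ((Nat.card G : ℂ)⁻¹ * (toRepresentation (σ i)).character g⁻¹), ← h0 g,
        Finset.mul_sum]
      exact Finset.sum_congr rfl fun j _ => by ring
    simp_rw [Representation.char_orthonormal] at key
    rw [Finset.sum_eq_single i] at key
    · rwa [if_pos ⟨Representation.Equiv.refl _⟩, mul_one] at key
    · intro j _ hj
      rw [if_neg fun h => hj (hne i j h).symm, mul_zero]
    · exact fun h => absurd hi h
  exact hlin.finite

theorem exists_unitary_isCompleteIrreducibleList (G : Type*) [Group G] [Finite G] :
    ∃ (k : ℕ) (d : Fin k → ℕ) (σ : ∀ i, G →* Matrix (Fin (d i)) (Fin (d i)) ℂ),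
      IsCompleteIrreducibleList σ ∧ ∀ i g, σ i g⁻¹ = (σ i g)ᴴ := by
  let Irr := Σ n : ℕ, {τ : G →* Matrix (Fin n) (Fin n) ℂ // (toRepresentation τ).IsIrreducible}
  let r : Setoid Irr :=
    { r := fun a b => Nonempty ((toRepresentation a.2.1).Equiv (toRepresentation b.2.1))
      iseqv := ⟨fun _ => ⟨.refl _⟩, fun ⟨φ⟩ => ⟨φ.symm⟩, fun ⟨φ⟩ ⟨ψ⟩ => ⟨φ.trans ψ⟩⟩ }
  have hfin : Finite (Quotient r) :=
    finite_of_pairwise_inequivalent (fun q : Quotient r => q.out.2.1) (fun q => q.out.2.2)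
      fun p q h => by rw [← p.out_eq, ← q.out_eq]; exact Quotient.sound h
  obtain ⟨k, ⟨f⟩⟩ := Finite.exists_equiv_fin (Quotient r)
  choose σ hσ φ using fun i => exists_unitary_equiv (f.symm i).out.2.1
  refine ⟨k, fun i => (f.symm i).out.1, σ, ⟨fun i => ?_, fun i j h => ?_, fun n τ hτ => ?_⟩, hσ⟩
  · exact isIrreducible_of_equiv (φ i).some (f.symm i).out.2.2
  · obtain ⟨ψ⟩ := h
    apply f.symm.injective
    rw [← (f.symm i).out_eq, ← (f.symm j).out_eq]
    exact Quotient.sound ⟨((φ i).some.trans ψ).trans (φ j).some.symm⟩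
  · let a : Irr := ⟨n, τ, hτ⟩
    obtain ⟨ψ⟩ : r.r a (f.symm (f ⟦a⟧)).out := by
      rw [f.symm_apply_apply]
      exact r.symm (Quotient.mk_out a)
    exact ⟨f ⟦a⟧, ⟨ψ.trans (φ _).some⟩⟩

theorem directSum_inv_eq_conjTranspose {k : ℕ} {d : Fin k → ℕ}
    {σ : ∀ i, G →* Matrix (Fin (d i)) (Fin (d i)) ℂ} (h : ∀ i g, σ i g⁻¹ = (σ i g)ᴴ) (g : G) :
    directSum σ g⁻¹ = (directSum σ g)ᴴ := by
  change Matrix.blockDiagonal' (fun i => σ i g⁻¹) = (Matrix.blockDiagonal' fun i => σ i g)ᴴ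
  rw [Matrix.blockDiagonal'_conjTranspose]
  simp_rw [h]

/-- The trivial representation is irreducible, so a complete list contains an irreducible
representation, and that one has positive degree. -/
theorem IsCompleteIrreducibleList.nonempty {k : ℕ} {d : Fin k → ℕ}
    {σ : ∀ i, G →* Matrix (Fin (d i)) (Fin (d i)) ℂ} (h : IsCompleteIrreducibleList σ) :
    Nonempty (Σ i, Fin (d i)) := by
  have h1 : (toRepresentation (1 : G →* Matrix (Fin 1) (Fin 1) ℂ)).IsIrreducible := by
    have : Nontrivial (Subrepresentation
        (toRepresentation (1 : G →* Matrix (Fin 1) (Fin 1) ℂ))) := by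
      refine ⟨⊥, ⊤, fun h => ?_⟩
      have h2 : (1 : Fin 1 → ℂ) ∈ (⊥ : Submodule ℂ (Fin 1 → ℂ)) := by
        have := congrArg Subrepresentation.toSubmodule h
        change (⊥ : Submodule ℂ (Fin 1 → ℂ)) = ⊤ at this
        rw [this]; trivial
      exact one_ne_zero ((Submodule.mem_bot ℂ).1 h2)
    refine ⟨fun W => ?_⟩
    have : IsSimpleOrder (Submodule ℂ (Fin 1 → ℂ)) :=
      is_simple_module_of_finrank_eq_one (A := ℂ) (Module.finrank_fin_fun ℂ)
    exact (eq_bot_or_eq_top W.toSubmodule).imp (fun h => Subrepresentation.toSubmodule_injective h)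
      fun h => Subrepresentation.toSubmodule_injective h
  obtain ⟨i, ⟨φ⟩⟩ := h.complete 1 1 h1
  refine ⟨i, ⟨0, Nat.pos_of_ne_zero fun h0 => ?_⟩⟩
  have : IsEmpty (Fin (d i)) := by rw [h0]; infer_instance
  exact one_ne_zero (φ.toLinearEquiv.injective (Subsingleton.elim (φ.toLinearEquiv 1)
    (φ.toLinearEquiv 0)))

end Group

variable {S : Type*} [Semigroup S]

/-! ### Green's relations in a finite semigroup -/

theorem exists_coe_eq_mul_coe (u : WithOne S) (a : S) : ∃ c : S, (c : WithOne S) = u * a := by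
  induction u with
  | one => exact ⟨a, (one_mul _).symm⟩
  | coe u => exact ⟨u * a, WithOne.coe_mul u a⟩

theorem exists_coe_eq_coe_mul (u : WithOne S) (a : S) : ∃ c : S, (c : WithOne S) = a * u := by
  induction u with
  | one => exact ⟨a, (mul_one _).symm⟩
  | coe u => exact ⟨a * u, WithOne.coe_mul a u⟩

theorem greenL_of_eq_mul {a b u v : S} (h : a = u * b) (h' : b = v * a) : GreenL a b :=
  greenL_iff.2 ⟨⟨u, by rw [← WithOne.coe_mul, ← h]⟩, ⟨v, by rw [← WithOne.coe_mul, ← h']⟩⟩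

theorem greenR_of_eq_mul {a b u v : S} (h : a = b * u) (h' : b = a * v) : GreenR a b :=
  greenR_iff.2 ⟨⟨u, by rw [← WithOne.coe_mul, ← h]⟩, ⟨v, by rw [← WithOne.coe_mul, ← h']⟩⟩

theorem GreenL.exists_eq_mul {e x : S} (he : IsIdempotentElem e) (h : GreenL x e) :
    ∃ u : S, e = u * x := by
  obtain ⟨u, hu⟩ := (greenL_iff.1 h).2
  obtain ⟨c, hc⟩ := exists_coe_eq_coe_mul u e
  refine ⟨c, WithOne.coe_injective ?_⟩
  rw [WithOne.coe_mul, hc, mul_assoc, ← hu, ← WithOne.coe_mul, he.eq]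

theorem GreenR.exists_eq_mul {e y : S} (he : IsIdempotentElem e) (h : GreenR y e) :
    ∃ u : S, e = y * u := by
  obtain ⟨u, hu⟩ := (greenR_iff.1 h).2
  obtain ⟨c, hc⟩ := exists_coe_eq_mul_coe u e
  refine ⟨c, WithOne.coe_injective ?_⟩
  rw [WithOne.coe_mul, hc, ← mul_assoc, ← hu, ← WithOne.coe_mul, he.eq]

theorem exists_eq_mul_of_mem_twoSidedIdeal {e f : S} (hf : IsIdempotentElem f)
    (h : e ∈ twoSidedIdeal f) : ∃ c d : S, e = c * d ∧ c * f = c ∧ f * d = d := by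
  obtain ⟨u, v, huv⟩ := h
  obtain ⟨c, hc⟩ := exists_coe_eq_mul_coe u f
  obtain ⟨d, hd⟩ := exists_coe_eq_coe_mul v f
  refine ⟨c, d, WithOne.coe_injective ?_, WithOne.coe_injective ?_, WithOne.coe_injective ?_⟩
  · rw [WithOne.coe_mul, hc, hd, huv, ← mul_assoc (u * f), mul_assoc u f f, ← WithOne.coe_mul,
      hf.eq]
  · rw [WithOne.coe_mul, hc, mul_assoc, ← WithOne.coe_mul, hf.eq]
  · rw [WithOne.coe_mul, hd, ← mul_assoc, ← WithOne.coe_mul, hf.eq]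

theorem mul_eq_one_symm_of_finite {M : Type*} [Monoid M] [Finite M] {a b : M} (h : a * b = 1) :
    b * a = 1 := by
  have hinj : Function.Injective (b * ·) := fun x y hxy => by
    have := congrArg (a * ·) hxy
    simpa only [← mul_assoc, h, one_mul] using this
  obtain ⟨c, hc : b * c = 1⟩ := Finite.surjective_of_injective hinj 1
  rwa [left_inv_eq_right_inv h hc]

/-- In a finite semigroup, `𝓙`-related idempotents `e` and `f` are `𝓓`-related: there are
`p ∈ R_e ∩ L_f` and `q ∈ R_f ∩ L_e` with `e = p q`. -/
theorem GreenJ.exists_eq_mul [Finite S] {e f : S} (he : IsIdempotentElem e)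
    (hf : IsIdempotentElem f) (h : GreenJ f e) :
    ∃ p q : S, e = p * q ∧ e * p = p ∧ q * e = q ∧ GreenL p f ∧ GreenR q f := by
  have hself : ∀ a : S, a ∈ twoSidedIdeal a := fun a => ⟨1, 1, by rw [one_mul, mul_one]⟩
  obtain ⟨c, d, hcd, hcf, hfd⟩ := exists_eq_mul_of_mem_twoSidedIdeal hf (h ▸ hself e)
  obtain ⟨c', d', hcd', hce, hed⟩ := exists_eq_mul_of_mem_twoSidedIdeal he (h.symm ▸ hself f)
  -- One-sided inverses in the finite local monoid `f S f` are two-sided.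
  let A : hf.Corner := ⟨f * (c' * c) * f, c' * c, rfl⟩
  let B : hf.Corner := ⟨f * (d * d') * f, d * d', rfl⟩
  have hAB : A * B = 1 := by
    refine Subtype.ext ?_
    change f * (c' * c) * f * (f * (d * d') * f) = f
    calc f * (c' * c) * f * (f * (d * d') * f)
        = f * (c' * (c * f) * (f * d) * d') * f := by simp only [mul_assoc]
      _ = f * (c' * (c * d) * d') * f := by rw [hcf, hfd]; simp only [mul_assoc]
      _ = f := by rw [← hcd, hce, ← hcd', hf.eq, hf.eq]
  have : Finite hf.Corner := Subtype.finite
  have hBA := congrArg Subtype.val (mul_eq_one_symm_of_finite (M := hf.Corner) hAB)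
  change f * (d * d') * f * (f * (c' * c) * f) = f at hBA
  have hp : f = f * d * d' * f * f * c' * (e * c) := by
    calc f = f * (d * d') * f * (f * (c' * c) * f) := hBA.symm
      _ = f * d * d' * f * f * (c' * e) * (c * f) := by rw [hce]; simp only [mul_assoc]
      _ = _ := by rw [hcf]; simp only [mul_assoc]
  have hq : f = d * e * (d' * f * f * c' * c * f) := by
    calc f = f * (d * d') * f * (f * (c' * c) * f) := hBA.symm
      _ = f * d * (e * d') * f * f * c' * c * f := by rw [hed]; simp only [mul_assoc]
      _ = _ := by rw [hfd]; simp only [mul_assoc]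
  refine ⟨e * c, d * e, ?_, ?_, ?_, ?_, ?_⟩
  · rw [mul_assoc, ← mul_assoc c, ← hcd, he.eq, he.eq]
  · rw [← mul_assoc, he.eq]
  · rw [mul_assoc, he.eq]
  · exact greenL_of_eq_mul (u := e * c) (by rw [mul_assoc, hcf]) hp
  · exact greenR_of_eq_mul (u := d * e) (by rw [← mul_assoc, hfd]) hq

/-! ### Inverse semigroups -/

theorem isInverseSemigroup_of_forall_idempotent (hS : IsRegularSemigroup S)
    (hL : ∀ e f : S, IsIdempotentElem e → IsIdempotentElem f → e * f = e → f * e = f → e = f)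
    (hR : ∀ e f : S, IsIdempotentElem e → IsIdempotentElem f → e * f = f → f * e = e → e = f) :
    IsInverseSemigroup S := by
  intro a
  obtain ⟨b, hb⟩ := hS a
  refine ⟨b * a * b, ⟨?_, ?_⟩, ?_⟩
  · grind
  · grind
  · have key : ∀ b c : S, a * b * a = a ∧ b * a * b = b → a * c * a = a ∧ c * a * c = c →
        b = c := by
      rintro b c ⟨h1, h2⟩ ⟨h3, h4⟩
      have h5 : a * b = a * c := by
        apply hR <;> simp only [IsIdempotentElem, ← mul_assoc, h1, h3]
      have h6 : b * a = c * a := by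
        apply hL <;> simp only [IsIdempotentElem, mul_assoc] <;> simp only [← mul_assoc a, h1, h3]
      rw [← h2, h6, mul_assoc, h5, ← mul_assoc, h4]
    exact fun c hc => key _ _ hc ⟨by grind, by grind⟩

namespace IsInverseSemigroup

theorem isIdempotentElem_mul (hS : IsInverseSemigroup S) {e f : S} (he : IsIdempotentElem e)
    (hf : IsIdempotentElem f) : IsIdempotentElem (e * f) := by
  obtain ⟨x, ⟨h1, h2⟩, -⟩ := hS (e * f)
  have he' : ∀ z, e * (e * z) = e * z := fun z => by rw [← mul_assoc, he.eq]
  have hf' : ∀ z, f * (f * z) = f * z := fun z => by rw [← mul_assoc, hf.eq]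
  simp only [mul_assoc] at h1 h2
  -- `f x e` is an idempotent which is inverse to `e f`; being inverse to itself, it equals `e f`.
  have h2' : ∀ z, x * (e * (f * (x * z))) = x * z := fun z => by
    have := congrArg (· * z) h2
    simpa only [mul_assoc] using this
  have hi : IsIdempotentElem (f * x * e) := by
    simp only [IsIdempotentElem, mul_assoc, h2']
  have h3 : e * f = f * x * e := by
    refine (hS (f * x * e)).unique ⟨?_, ?_⟩ ⟨?_, ?_⟩
    · simp only [mul_assoc, he', hf', h2']
    · simp only [mul_assoc, he', hf', h1]
    · rw [hi.eq, hi.eq]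
    · rw [hi.eq, hi.eq]
  rwa [h3]

theorem idempotent_mul_comm (hS : IsInverseSemigroup S) {e f : S} (he : IsIdempotentElem e)
    (hf : IsIdempotentElem f) : e * f = f * e := by
  have h1 := hS.isIdempotentElem_mul he hf
  have h2 := hS.isIdempotentElem_mul hf he
  have he' : ∀ z, e * (e * z) = e * z := fun z => by rw [← mul_assoc, he.eq]
  have hf' : ∀ z, f * (f * z) = f * z := fun z => by rw [← mul_assoc, hf.eq]
  refine (hS (e * f)).unique ⟨by rw [h1.eq, h1.eq], by rw [h1.eq, h1.eq]⟩ ⟨?_, ?_⟩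
  · simp only [IsIdempotentElem, mul_assoc] at h1
    simp only [mul_assoc, he', hf', h1]
  · simp only [IsIdempotentElem, mul_assoc] at h2
    simp only [mul_assoc, he', hf', h2]

/-- If `s` does not move `x` out of its `𝓛`-class, then `t = s⁻¹` takes `s x` back to `x`: this
holds because the idempotents `t s` and `x x⁻¹` commute. -/
theorem mul_mul_eq_of_eq_mul (hS : IsInverseSemigroup S) {s t x u : S} (hst : s * t * s = s)
    (hx : x = u * (s * x)) : t * (s * x) = x := by
  obtain ⟨y, ⟨hy, -⟩, -⟩ := hS x
  have hf : IsIdempotentElem (t * s) := by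
    rw [IsIdempotentElem, mul_assoc, ← mul_assoc s, hst]
  have hp : IsIdempotentElem (x * y) := by rw [IsIdempotentElem, ← mul_assoc, hy]
  have hc : x * y * (t * s) = t * s * (x * y) := hS.idempotent_mul_comm hp hf
  have h1 : u * s * (x * y) = x * y := by rw [mul_assoc, ← mul_assoc s, ← mul_assoc, ← hx]
  have h3 : u * s * (t * s) = u * s := by rw [mul_assoc, ← mul_assoc s, hst]
  have h2 : x * y = t * s * (x * y) := by
    calc x * y = u * s * (x * y) := h1.symm
      _ = u * s * (t * s * (x * y)) := by rw [← mul_assoc (u * s) (t * s), h3]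
      _ = u * s * (x * y) * (t * s) := by rw [← hc, ← mul_assoc (u * s)]
      _ = _ := by rw [h1, hc]
  calc t * (s * x) = t * s * (x * y) * x := by rw [mul_assoc (t * s), hy, mul_assoc]
    _ = x := by rw [← h2, hy]

/-- If `s` does not move `y` out of its `𝓡`-class, then `t = s⁻¹` takes `y s` back to `y`: this
holds because the idempotents `s t` and `y⁻¹ y` commute. -/
theorem mul_mul_eq_of_eq_mul' (hS : IsInverseSemigroup S) {s t y u : S} (hst : s * t * s = s)
    (hy : y = y * s * u) : y * s * t = y := by
  obtain ⟨x, ⟨hx, -⟩, -⟩ := hS y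
  have hf : IsIdempotentElem (s * t) := by rw [IsIdempotentElem, ← mul_assoc, hst]
  have hp : IsIdempotentElem (x * y) := by
    rw [IsIdempotentElem, mul_assoc, ← mul_assoc y, hx]
  have hc : x * y * (s * t) = s * t * (x * y) := hS.idempotent_mul_comm hp hf
  have h1 : x * y * (s * u) = x * y := by rw [mul_assoc, ← mul_assoc y, ← hy]
  have h2 : x * y = x * y * (s * t) := by
    calc x * y = x * y * (s * u) := h1.symm
      _ = x * y * (s * t) * (s * u) := by
        rw [mul_assoc (x * y) (s * t), ← mul_assoc (s * t), hst]
      _ = s * t * (x * y * (s * u)) := by rw [hc, mul_assoc]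
      _ = _ := by rw [h1, hc]
  calc y * s * t = y * (x * y * (s * t)) := by rw [← mul_assoc y, ← mul_assoc y, hx, mul_assoc]
    _ = y := by rw [← h2, ← mul_assoc, hx]

end IsInverseSemigroup

/-! ### Transversals -/

section Transversals

variable {e : S}

theorem exists_leftTransversal [Finite S] (he : IsIdempotentElem e) :
    ∃ m, Nonempty (LeftTransversal he m) := by
  let r : Setoid {l : S // GreenL l e} :=
    { r := fun a b => ∃ g : MaxSubgroup he, a.1 = b.1 * g.val
      iseqv := by
        refine ⟨fun a => ⟨1, (mul_idem_of_greenL he a.2).symm⟩, ?_, ?_⟩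
        · rintro a b ⟨g, hg⟩
          exact ⟨g⁻¹, by rw [hg, mul_assoc, g.val_mul_inv, mul_idem_of_greenL he b.2]⟩
        · rintro a b c ⟨g, hg⟩ ⟨h, hh⟩
          exact ⟨h * g, by rw [hg, hh, mul_assoc, MaxSubgroup.val_mul]⟩ }
  obtain ⟨m, ⟨f⟩⟩ := Finite.exists_equiv_fin (Quotient r)
  refine ⟨m, ⟨⟨fun i => (f.symm i).out.1, fun i => (f.symm i).out.2, fun l hl => ?_,
    fun i j g h H => ?_⟩⟩⟩
  · obtain ⟨g, hg⟩ : r.r ⟨l, hl⟩ (f.symm (f ⟦⟨l, hl⟩⟧)).out := by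
      rw [f.symm_apply_apply]
      exact r.symm (Quotient.mk_out _)
    exact ⟨_, g, hg⟩
  · apply f.symm.injective
    rw [← (f.symm i).out_eq, ← (f.symm j).out_eq]
    refine Quotient.sound ⟨h * g⁻¹, ?_⟩
    rw [MaxSubgroup.val_mul, ← mul_assoc, ← H, mul_assoc, g.val_mul_inv,
      mul_idem_of_greenL he (f.symm i).out.2]

theorem exists_rightTransversal [Finite S] (he : IsIdempotentElem e) :
    ∃ n, Nonempty (RightTransversal he n) := by
  let r : Setoid {l : S // GreenR l e} :=
    { r := fun a b => ∃ g : MaxSubgroup he, a.1 = g.val * b.1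
      iseqv := by
        refine ⟨fun a => ⟨1, (idem_mul_of_greenR he a.2).symm⟩, ?_, ?_⟩
        · rintro a b ⟨g, hg⟩
          exact ⟨g⁻¹, by rw [hg, ← mul_assoc, g.inv_mul_val, idem_mul_of_greenR he b.2]⟩
        · rintro a b c ⟨g, hg⟩ ⟨h, hh⟩
          exact ⟨g * h, by rw [hg, hh, ← mul_assoc, MaxSubgroup.val_mul]⟩ }
  obtain ⟨n, ⟨f⟩⟩ := Finite.exists_equiv_fin (Quotient r)
  refine ⟨n, ⟨⟨fun i => (f.symm i).out.1, fun i => (f.symm i).out.2, fun l hl => ?_,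
    fun i j g h H => ?_⟩⟩⟩
  · obtain ⟨g, hg⟩ : r.r ⟨l, hl⟩ (f.symm (f ⟦⟨l, hl⟩⟧)).out := by
      rw [f.symm_apply_apply]
      exact r.symm (Quotient.mk_out _)
    exact ⟨_, g, hg⟩
  · apply f.symm.injective
    rw [← (f.symm i).out_eq, ← (f.symm j).out_eq]
    refine Quotient.sound ⟨g⁻¹ * h, ?_⟩
    rw [MaxSubgroup.val_mul, mul_assoc, ← H, ← mul_assoc, g.inv_mul_val,
      idem_mul_of_greenR he (f.symm i).out.2]

end Transversals

/-! ### Semiunitarity over an inverse semigroup -/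

section Semiunitary

variable {e : S} {he : IsIdempotentElem e} {m n : ℕ} {d : Type*} [Fintype d] [DecidableEq d]

/-- On `L_e`, the partial injection given by `t = s⁻¹` is inverse to that given by `s`. -/
theorem LeftTransversal.mul_eq_of_mul_eq (X : LeftTransversal he m) (hS : IsInverseSemigroup S)
    {s t : S} (hst : s * t * s = s) {i j : Fin m} {g : MaxSubgroup he}
    (H : s * X.x i = X.x j * g.val) : t * X.x j = X.x i * MaxSubgroup.val g⁻¹ := by
  have hj : X.x j = s * X.x i * MaxSubgroup.val g⁻¹ := by
    rw [H, mul_assoc, g.val_mul_inv, mul_idem_of_greenL he (X.mem j)]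
  obtain ⟨u, hu⟩ := (X.mem j).exists_eq_mul he
  have hx : X.x i = X.x i * MaxSubgroup.val g⁻¹ * u * (s * X.x i) := by
    calc X.x i = X.x i * (MaxSubgroup.val g⁻¹ * g.val) := by
          rw [g.inv_mul_val, mul_idem_of_greenL he (X.mem i)]
      _ = X.x i * (MaxSubgroup.val g⁻¹ * (e * g.val)) := by rw [g.idem_mul]
      _ = _ := by rw [congrArg (· * g.val) hu, H]; simp only [mul_assoc]
  rw [hj, ← mul_assoc, hS.mul_mul_eq_of_eq_mul hst hx]

/-- On `R_e`, the partial injection given by `t = s⁻¹` is inverse to that given by `s`. -/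
theorem RightTransversal.mul_eq_of_mul_eq (Y : RightTransversal he n) (hS : IsInverseSemigroup S)
    {s t : S} (hst : s * t * s = s) {i j : Fin n} {g : MaxSubgroup he}
    (H : Y.y j * s = g.val * Y.y i) : Y.y i * t = MaxSubgroup.val g⁻¹ * Y.y j := by
  have hi : Y.y i = MaxSubgroup.val g⁻¹ * (Y.y j * s) := by
    rw [H, ← mul_assoc, g.inv_mul_val, idem_mul_of_greenR he (Y.mem i)]
  obtain ⟨u, hu⟩ := (Y.mem i).exists_eq_mul he
  have hy : Y.y j = Y.y j * s * (u * (MaxSubgroup.val g⁻¹ * Y.y j)) := by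
    calc Y.y j = g.val * MaxSubgroup.val g⁻¹ * Y.y j := by
          rw [g.val_mul_inv, idem_mul_of_greenR he (Y.mem j)]
      _ = g.val * e * MaxSubgroup.val g⁻¹ * Y.y j := by rw [g.mul_idem]
      _ = _ := by rw [congrArg (g.val * ·) hu, H]; simp only [mul_assoc]
  rw [hi, mul_assoc, hS.mul_mul_eq_of_eq_mul' hst hy]

theorem isSemiunitary_indRep (X : LeftTransversal he m) (hS : IsInverseSemigroup S)
    {σ : MaxSubgroup he →* Matrix d d ℂ} (hσ : ∀ g, σ g⁻¹ = (σ g)ᴴ) :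
    IsSemiunitary (indRep X σ) := by
  intro s
  obtain ⟨t, ⟨h1, h2⟩, -⟩ := hS s
  have ht : indRep X σ t = (indRep X σ s)ᴴ := by
    refine applyEntries_eq_conjTranspose hσ fun i j => ?_
    by_cases h : ∃ g : MaxSubgroup he, s * X.x i = X.x j * g.val
    · obtain ⟨g, hg⟩ := h
      exact Or.inr ⟨g, X.schutzMatrix_eq hg, X.schutzMatrix_eq (X.mul_eq_of_mul_eq hS h1 hg)⟩
    · exact Or.inl ⟨X.schutzMatrix_eq_zero fun g hg => h ⟨g, hg⟩,
        X.schutzMatrix_eq_zero fun g hg => h ⟨g⁻¹, X.mul_eq_of_mul_eq hS h2 hg⟩⟩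
  rw [IsPreunitary, ← ht, ← map_mul, ← map_mul, h1]

theorem isSemiunitary_coindRep (Y : RightTransversal he n) (hS : IsInverseSemigroup S)
    {σ : MaxSubgroup he →* Matrix d d ℂ} (hσ : ∀ g, σ g⁻¹ = (σ g)ᴴ) :
    IsSemiunitary (coindRep Y σ) := by
  intro s
  obtain ⟨t, ⟨h1, h2⟩, -⟩ := hS s
  have ht : coindRep Y σ t = (coindRep Y σ s)ᴴ := by
    refine applyEntries_eq_conjTranspose hσ fun i j => ?_
    by_cases h : ∃ g : MaxSubgroup he, Y.y j * s = g.val * Y.y i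
    · obtain ⟨g, hg⟩ := h
      exact Or.inr ⟨g, Y.schutzMatrix_eq hg, Y.schutzMatrix_eq (Y.mul_eq_of_mul_eq hS h1 hg)⟩
    · exact Or.inl ⟨Y.schutzMatrix_eq_zero fun g hg => h ⟨g, hg⟩,
        Y.schutzMatrix_eq_zero fun g hg => h ⟨g⁻¹, Y.mul_eq_of_mul_eq hS h2 hg⟩⟩
  rw [IsPreunitary, ← ht, ← map_mul, ← map_mul, h1]

theorem IsInverseSemigroup.hasSemiunitarySchutzenbergerPair [Finite S]
    (hS : IsInverseSemigroup S) (a : S) : HasSemiunitarySchutzenbergerPair a := by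
  obtain ⟨b, ⟨hb, -⟩, -⟩ := hS a
  have he : IsIdempotentElem (a * b) := by rw [IsIdempotentElem, ← mul_assoc, hb]
  have hJ : GreenJ (a * b) a := by
    ext c
    constructor
    · rintro ⟨u, v, h⟩
      exact ⟨u, b * v, by rw [h, WithOne.coe_mul]; simp only [mul_assoc]⟩
    · rintro ⟨u, v, h⟩
      refine ⟨u, a * v, ?_⟩
      rw [h, mul_assoc u (_ : WithOne S) (_ * v), ← mul_assoc _ (a : WithOne S) v,
        ← WithOne.coe_mul (a * b), hb, ← mul_assoc]
  have : Finite he.Corner := Subtype.finite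
  obtain ⟨m, ⟨X⟩⟩ := exists_leftTransversal he
  obtain ⟨n, ⟨Y⟩⟩ := exists_rightTransversal he
  obtain ⟨k, d, σ, hσ, hu⟩ := exists_unitary_isCompleteIrreducibleList (MaxSubgroup he)
  exact ⟨a * b, he, hJ, m, n, X, Y, k, d, σ, hσ,
    isSemiunitary_indRep X hS (directSum_inv_eq_conjTranspose hu),
    isSemiunitary_coindRep Y hS (directSum_inv_eq_conjTranspose hu)⟩

/-! ### Idempotents in the presence of semiunitary representations -/

/-- A semiunitary `Ind σ` identifies `𝓛`-related idempotents, and its diagonal blocks show which of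
them fix an element of `L_e`. -/
theorem mul_eq_of_isSemiunitary_indRep [Nonempty d] {X : LeftTransversal he m}
    {σ : MaxSubgroup he →* Matrix d d ℂ} (h : IsSemiunitary (indRep X σ)) {a b x : S}
    (ha : IsIdempotentElem a) (hb : IsIdempotentElem b) (hab : a * b = a) (hba : b * a = b)
    (hx : GreenL x e) (hax : a * x = x) : b * x = x := by
  have hA := (h a).isHermitian_of_isIdempotentElem (ha.map _)
  have hB := (h b).isHermitian_of_isIdempotentElem (hb.map _)
  have hAB : indRep X σ a = indRep X σ b := by
    calc indRep X σ a = (indRep X σ a * indRep X σ b)ᴴ := by rw [← map_mul, hab, hA.eq]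
      _ = indRep X σ b := by rw [Matrix.conjTranspose_mul, hA.eq, hB.eq, ← map_mul, hba]
  obtain ⟨i, g, hg⟩ := X.cover x hx
  have hxi : X.x i = x * MaxSubgroup.val g⁻¹ := by
    rw [hg, mul_assoc, g.val_mul_inv, mul_idem_of_greenL he (X.mem i)]
  have hai : a * X.x i = X.x i * MaxSubgroup.val (1 : MaxSubgroup he) := by
    rw [MaxSubgroup.val_one, mul_idem_of_greenL he (X.mem i), hxi, ← mul_assoc, hax]
  obtain ⟨p⟩ := ‹Nonempty d›
  have h1 : indRep X σ a (i, p) (i, p) = 1 := by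
    change applyEntries σ (X.schutzMatrix a) (i, p) (i, p) = 1
    rw [applyEntries_apply, X.schutzMatrix_eq hai, MonoidAlgebra.lift_single, map_one, one_smul,
      Matrix.one_apply_eq]
  obtain ⟨k, hk⟩ : ∃ k : MaxSubgroup he, b * X.x i = X.x i * k.val := by
    by_contra! hk
    rw [hAB] at h1
    change applyEntries σ (X.schutzMatrix b) (i, p) (i, p) = 1 at h1
    rw [applyEntries_apply, X.schutzMatrix_eq_zero hk, map_zero, Matrix.zero_apply] at h1
    exact zero_ne_one h1
  have hbi : X.x i = b * (X.x i * MaxSubgroup.val k⁻¹) := by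
    rw [← mul_assoc, hk, mul_assoc, k.val_mul_inv, mul_idem_of_greenL he (X.mem i)]
  rw [hg, hbi, ← mul_assoc, ← mul_assoc, hb.eq]

/-- A semiunitary `Coind σ` identifies `𝓡`-related idempotents, and its diagonal blocks show which
of them fix an element of `R_e`. -/
theorem mul_eq_of_isSemiunitary_coindRep [Nonempty d] {Y : RightTransversal he n}
    {σ : MaxSubgroup he →* Matrix d d ℂ} (h : IsSemiunitary (coindRep Y σ)) {a b y : S}
    (ha : IsIdempotentElem a) (hb : IsIdempotentElem b) (hab : a * b = b) (hba : b * a = a)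
    (hy : GreenR y e) (hya : y * a = y) : y * b = y := by
  have hA := (h a).isHermitian_of_isIdempotentElem (ha.map _)
  have hB := (h b).isHermitian_of_isIdempotentElem (hb.map _)
  have hAB : coindRep Y σ a = coindRep Y σ b := by
    calc coindRep Y σ a = (coindRep Y σ b * coindRep Y σ a)ᴴ := by rw [← map_mul, hba, hA.eq]
      _ = coindRep Y σ b := by rw [Matrix.conjTranspose_mul, hA.eq, hB.eq, ← map_mul, hab]
  obtain ⟨i, g, hg⟩ := Y.cover y hy
  have hyi : Y.y i = MaxSubgroup.val g⁻¹ * y := by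
    rw [hg, ← mul_assoc, g.inv_mul_val, idem_mul_of_greenR he (Y.mem i)]
  have hai : Y.y i * a = MaxSubgroup.val (1 : MaxSubgroup he) * Y.y i := by
    rw [MaxSubgroup.val_one, idem_mul_of_greenR he (Y.mem i), hyi, mul_assoc, hya]
  obtain ⟨p⟩ := ‹Nonempty d›
  have h1 : coindRep Y σ a (i, p) (i, p) = 1 := by
    change applyEntries σ (Y.schutzMatrix a) (i, p) (i, p) = 1
    rw [applyEntries_apply, Y.schutzMatrix_eq hai, MonoidAlgebra.lift_single, map_one, one_smul,
      Matrix.one_apply_eq]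
  obtain ⟨k, hk⟩ : ∃ k : MaxSubgroup he, Y.y i * b = k.val * Y.y i := by
    by_contra! hk
    rw [hAB] at h1
    change applyEntries σ (Y.schutzMatrix b) (i, p) (i, p) = 1 at h1
    rw [applyEntries_apply, Y.schutzMatrix_eq_zero hk, map_zero, Matrix.zero_apply] at h1
    exact zero_ne_one h1
  have hbi : Y.y i = MaxSubgroup.val k⁻¹ * Y.y i * b := by
    rw [mul_assoc, hk, ← mul_assoc, k.inv_mul_val, idem_mul_of_greenR he (Y.mem i)]
  rw [hg, hbi, mul_assoc, mul_assoc (MaxSubgroup.val k⁻¹ * Y.y i), hb.eq]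

end Semiunitary

theorem isInverseSemigroup_of_hasSemiunitarySchutzenbergerPair [Finite S]
    (hS : IsRegularSemigroup S) (h : ∀ a : S, HasSemiunitarySchutzenbergerPair a) :
    IsInverseSemigroup S := by
  refine isInverseSemigroup_of_forall_idempotent hS (fun a b ha hb hab hba => ?_)
    fun a b ha hb hab hba => ?_
  · obtain ⟨e, he, hJ, m, n, X, Y, k, d, σ, hσ, hind, -⟩ := h a
    have := hσ.nonempty
    obtain ⟨p, q, hpq, hp, -, hpL, -⟩ := hJ.exists_eq_mul ha he
    have hbp : b * p = p := mul_eq_of_isSemiunitary_indRep hind ha hb hab hba hpL hp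
    rw [← hba, hpq, ← mul_assoc, hbp]
  · obtain ⟨e, he, hJ, m, n, X, Y, k, d, σ, hσ, -, hcoind⟩ := h a
    have := hσ.nonempty
    obtain ⟨p, q, hpq, -, hq, -, hqR⟩ := hJ.exists_eq_mul ha he
    have hqb : q * b = q := mul_eq_of_isSemiunitary_coindRep hcoind ha hb hab hba hqR hq
    rw [← hab, hpq, mul_assoc, hqb]

end SemigroupRep

theorem mainTheorem1 {S : Type*} [Semigroup S] [Finite S]
    (hS : SemigroupRep.IsRegularSemigroup S) :
    SemigroupRep.IsInverseSemigroup S ↔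
      ∀ a : S, SemigroupRep.HasSemiunitarySchutzenbergerPair a :=
  ⟨fun h => h.hasSemiunitarySchutzenbergerPair,
    SemigroupRep.isInverseSemigroup_of_hasSemiunitarySchutzenbergerPair hS⟩
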